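/- **Theorem (fractional Sobolev inequality on $\mathbb{R}$).** For $0<\sigma<1$ let ${}^{-}I^{\sigma}f(x)=\frac{1}{\Gamma(\sigma)}\int_{-\infty}^{x}(x-y)^{\sigma-1}f(y)\,dy$ and ${}^{+}I^{\sigma}f(x)=\frac{1}{\Gamma(\sigma)}\int_{x}^{\infty}(y-x)^{\sigma-1}f(y)\,dy$. For $0<\alpha<1$ and $\varphi\in C_0^\infty(\mathbb{R})$ let ${}^{-}D^{\alpha}\varphi=\frac{d}{dx}\,{}^{-}I^{1-\alpha}\varphi$ and ${}^{+}D^{\alpha}\varphi=-\frac{d}{dx}\,{}^{+}I^{1-\alpha}\varphi$ (the Riemann–Liouville derivatives). A function $v\in L^1_{loc}(\mathbb{R})$ is the weak fractional derivative ${}^{\pm}\mathcal{D}^{\alpha}u$ of $u$ if $$\int_{\mathbb{R}} v\,\varphi\,dx=\int_{\mathbb{R}}u\;{}^{\mp}D^{\alpha}\varphi\,dx\qquad\text{for all }\varphi\in C_0^\infty(\mathbb{R}).$$ Let ${}^{\pm}W^{\alpha,p}(\mathbb{R})=\{u\in L^p(\mathbb{R}) : {}^{\pm}\mathcal{D}^{\alpha}u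 \text{ exists and belongs to } L^p(\mathbb{R})\}$. All functions are real-valued. Let $0<\alpha<1$ and $1<p<\frac1\alpha$, and put $p^*=\frac{p}{1-\alpha p}$. For each choice of the sign $\pm$ there exists a constant $C>0$ (depending only on $\alpha$, $p$ and the sign) such that for every $u\in L^1(\mathbb{R})\cap{}^{\pm}W^{\alpha,p}(\mathbb{R})$, $$\|u\|_{L^{p^*}(\mathbb{R})}\le C\,\|{}^{\pm}\mathcal{D}^{\alpha}u\|_{L^p(\mathbb{R})}.$$ In particular, $u\in L^{p^*}(\mathbb{R})$. -/

import Mathlib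

open MeasureTheory Set
open scoped ContDiff ENNReal

/-- The two directions of fractional calculus on the line: `left` is written with a superscript
minus sign, `right` with a superscript plus sign. -/
inductive FracSide : Type
  | left
  | right

/-- The opposite direction. -/
def FracSide.opp : FracSide → FracSide
  | FracSide.left => FracSide.right
  | FracSide.right => FracSide.left

/-- The Riemann-Liouville fractional integral of order `σ` on the whole line: the left one is
`Γ(σ)⁻¹ ∫_{-∞}^x (x - y)^(σ - 1) f(y) dy`, the right one is
`Γ(σ)⁻¹ ∫_x^∞ (y - x)^(σ - 1) f(y) dy`. -/
noncomputable def fracIntegral (s : FracSide) (σ : ℝ) (f : ℝ → ℝ) (x : ℝ) : ℝ :=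
  match s with
  | FracSide.left => (Real.Gamma σ)⁻¹ * ∫ y in Iio x, (x - y) ^ (σ - 1) * f y
  | FracSide.right => (Real.Gamma σ)⁻¹ * ∫ y in Ioi x, (y - x) ^ (σ - 1) * f y

/-- The classical Riemann-Liouville fractional derivative of order `α`, `0 < α < 1`, on the whole
line: `d/dx` of the left fractional integral of order `1 - α`, and `-d/dx` of the right fractional
integral of order `1 - α`. -/
noncomputable def fracDeriv (s : FracSide) (α : ℝ) (f : ℝ → ℝ) (x : ℝ) : ℝ :=
  match s with
  | FracSide.left => deriv (fracIntegral FracSide.left (1 - α) f) x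
  | FracSide.right => -deriv (fracIntegral FracSide.right (1 - α) f) x

/-- `v` is the weak fractional derivative of `u` of order `α`, `0 < α < 1`, in the direction `s`,
on the whole line. It is tested against classical derivatives in the opposite direction; as
`0 < α < 1`, the integer part of `α` is zero and no sign occurs. -/
def IsWeakFracDeriv (s : FracSide) (α : ℝ) (u v : ℝ → ℝ) : Prop :=
  LocallyIntegrable v volume ∧
    ∀ φ : ℝ → ℝ, ContDiff ℝ ∞ φ → HasCompactSupport φ →
      ∫ x, v x * φ x = ∫ x, u x * fracDeriv s.opp α φ x

/-- The one-sided fractional Sobolev space of order `α`, `0 < α < 1`, and exponent `p` on the whole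
line: the functions in `L^p` that have a weak fractional derivative in `L^p`. -/
def fracSobolev (s : FracSide) (α : ℝ) (p : ℝ≥0∞) : Set (ℝ → ℝ) :=
  {u | MemLp u p volume ∧ ∃ v : ℝ → ℝ, MemLp v p volume ∧ IsWeakFracDeriv s α u v}

open Filter Topology

/-! A function is recovered from its fractional derivative: up to a positive constant, `u` is almost
everywhere the fractional integral of order `α` of `v`, and fractional integration maps `L^p` to
`L^{p*}`.

For the recovery, take the right side. The definition should be tested with the left integral of
order `α` of a test function `ψ`, since the left derivative returns a multiple of `ψ`
(`rlIntegral_rlIntegral_deriv`: the two kernels convolve to a constant on the half-line). This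
function is smooth but not compactly supported, so it is cut off at scale `n`. Left operators see
only the past, hence at a fixed point the cutoff is eventually invisible; `abs_rlIntegral_deriv_le`
bounds the derivatives uniformly in `n`, and `u ∈ L^1` then allows dominated convergence
(`integral_mul_rlIntegral_eq`). Fractional integration by parts moves the integral onto `v`, and the
fundamental lemma of the calculus of variations identifies `u`.

The mapping property is the Hardy-Littlewood-Sobolev inequality (`exists_eLpNorm_fracLIntegral_le`),
proved level by level: at level `s` both `f` and the kernel are truncated, the bounded pieces are
absorbed, and Chebyshev applied to the rest gives a bound that integrates in `s` to the `L^p` norm.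

The left side follows by reflection. -/

/-! ### Power integrals and the layer cake formula -/

theorem lintegral_Ioc_zero_rpow {β b : ℝ} (hβ : 0 < β) (hb : 0 ≤ b) :
    ∫⁻ s in Ioc 0 b, ENNReal.ofReal (s ^ (β - 1)) = ENNReal.ofReal (b ^ β / β) := by
  have hi : IntervalIntegrable (fun s : ℝ => s ^ (β - 1)) volume 0 b :=
    intervalIntegral.intervalIntegrable_rpow' (by linarith)
  rw [← ofReal_integral_eq_lintegral_ofReal ((intervalIntegrable_iff_integrableOn_Ioc_of_le hb).1 hi),
    ← intervalIntegral.integral_of_le hb, integral_rpow (Or.inl (by linarith))]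
  · simp [hβ.ne']
  · exact (ae_restrict_mem measurableSet_Ioc).mono fun s hs => Real.rpow_nonneg hs.1.le _

theorem lintegral_Ioi_rpow {γ R : ℝ} (hγ : γ < -1) (hR : 0 < R) :
    ∫⁻ s in Ioi R, ENNReal.ofReal (s ^ γ) = ENNReal.ofReal (R ^ (γ + 1) / (-(γ + 1))) := by
  rw [← ofReal_integral_eq_lintegral_ofReal (integrableOn_Ioi_rpow_of_lt hγ hR),
    integral_Ioi_rpow_of_lt hγ hR]
  · rw [div_neg, neg_div]
  · exact (ae_restrict_mem measurableSet_Ioi).mono fun s hs =>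
      Real.rpow_nonneg (hR.trans hs).le _

/-- Covers the value `⊤` in the layer cake formula. The upper limit `(r * β) ^ β⁻¹` makes the
truncated integral exactly `r`. -/
theorem lintegral_Ioi_zero_rpow_eq_top {β : ℝ} (hβ : 0 < β) :
    ∫⁻ s in Ioi (0 : ℝ), ENNReal.ofReal (s ^ (β - 1)) = ⊤ := by
  refine ENNReal.eq_top_of_forall_nnreal_le fun r => ?_
  have hb : 0 ≤ ((r : ℝ) * β) ^ β⁻¹ := by positivity
  calc (r : ℝ≥0∞) = ENNReal.ofReal ((((r : ℝ) * β) ^ β⁻¹) ^ β / β) := by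
        rw [Real.rpow_inv_rpow (by positivity) hβ.ne', mul_div_cancel_right₀ _ hβ.ne',
          ENNReal.ofReal_coe_nnreal]
    _ = ∫⁻ s in Ioc 0 (((r : ℝ) * β) ^ β⁻¹), ENNReal.ofReal (s ^ (β - 1)) :=
        (lintegral_Ioc_zero_rpow hβ hb).symm
    _ ≤ _ := lintegral_mono_set Ioc_subset_Ioi_self

/-- The pointwise layer cake formula for a power of an extended nonnegative number. -/
theorem lintegral_indicator_ofReal_lt {β : ℝ} (hβ : 0 < β) (a : ℝ≥0∞) :
    ∫⁻ s in Ioi (0 : ℝ), {s : ℝ | ENNReal.ofReal s < a}.indicator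
      (fun s => ENNReal.ofReal (s ^ (β - 1))) s = a ^ β / ENNReal.ofReal β := by
  rcases eq_or_ne a ⊤ with rfl | ha
  · have : {s : ℝ | ENNReal.ofReal s < ⊤} = univ := by ext; simp
    rw [this, ENNReal.top_rpow_of_pos hβ, ENNReal.top_div_of_ne_top ENNReal.ofReal_ne_top]
    simpa using lintegral_Ioi_zero_rpow_eq_top hβ
  · lift a to NNReal using ha
    have hset : {s : ℝ | ENNReal.ofReal s < a} ∩ Ioi 0 = Ioo 0 (a : ℝ) := by
      ext s
      simp only [mem_inter_iff, mem_ofPred_eq, mem_Ioi, mem_Ioo]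
      constructor
      · rintro ⟨h, h0⟩
        refine ⟨h0, ?_⟩
        rw [← ENNReal.ofReal_coe_nnreal, ENNReal.ofReal_lt_ofReal_iff_of_nonneg h0.le] at h
        exact h
      · rintro ⟨h0, h⟩
        refine ⟨?_, h0⟩
        rwa [← ENNReal.ofReal_coe_nnreal, ENNReal.ofReal_lt_ofReal_iff_of_nonneg h0.le]
    have hm : MeasurableSet {s : ℝ | ENNReal.ofReal s < a} :=
      measurableSet_lt ENNReal.measurable_ofReal measurable_const
    rw [lintegral_indicator hm, Measure.restrict_restrict hm, hset,
      setLIntegral_congr Ioo_ae_eq_Ioc, lintegral_Ioc_zero_rpow hβ a.coe_nonneg,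
      ENNReal.ofReal_div_of_pos hβ, ← ENNReal.ofReal_rpow_of_nonneg a.coe_nonneg hβ.le,
      ENNReal.ofReal_coe_nnreal]

/-- The layer cake formula, with a weight. -/
theorem lintegral_mul_rpow_eq_lintegral_Ioi {β : ℝ} (hβ : 0 < β) {w g : ℝ → ℝ≥0∞}
    (hw : Measurable w) (hg : Measurable g) :
    ∫⁻ x, w x * g x ^ β = ENNReal.ofReal β * ∫⁻ s in Ioi (0 : ℝ), ENNReal.ofReal (s ^ (β - 1)) *
      ∫⁻ x, {x | ENNReal.ofReal s < g x}.indicator w x := by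
  have hβ0 : ENNReal.ofReal β ≠ 0 := by simpa using hβ
  have hm : MeasurableSet {z : ℝ × ℝ | ENNReal.ofReal z.2 < g z.1} :=
    measurableSet_lt (by fun_prop) (by fun_prop)
  have key : ∀ x, w x * g x ^ β = ENNReal.ofReal β * ∫⁻ s in Ioi (0 : ℝ),
      {z : ℝ × ℝ | ENNReal.ofReal z.2 < g z.1}.indicator
        (fun z => ENNReal.ofReal (z.2 ^ (β - 1)) * w z.1) (x, s) := by
    intro x
    have h1 := lintegral_indicator_ofReal_lt hβ (g x)
    have h2 : ∀ s : ℝ, {z : ℝ × ℝ | ENNReal.ofReal z.2 < g z.1}.indicator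
        (fun z => ENNReal.ofReal (z.2 ^ (β - 1)) * w z.1) (x, s) =
        w x * {s : ℝ | ENNReal.ofReal s < g x}.indicator
          (fun s => ENNReal.ofReal (s ^ (β - 1))) s := by
      intro s
      by_cases h : ENNReal.ofReal s < g x <;> simp [indicator, h, mul_comm]
    simp_rw [h2]
    rw [lintegral_const_mul, h1, mul_left_comm,
      ENNReal.mul_div_cancel hβ0 ENNReal.ofReal_ne_top]
    exact Measurable.indicator (by fun_prop)
      (measurableSet_lt ENNReal.measurable_ofReal measurable_const)
  have hm2 : Measurable ({z : ℝ × ℝ | ENNReal.ofReal z.2 < g z.1}.indicator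
        (fun z => ENNReal.ofReal (z.2 ^ (β - 1)) * w z.1)) :=
    Measurable.indicator (by fun_prop) hm
  simp_rw [key]
  rw [lintegral_const_mul _ (Measurable.lintegral_prod_right' hm2),
    lintegral_lintegral_swap (f := fun x s => {z : ℝ × ℝ | ENNReal.ofReal z.2 < g z.1}.indicator
        (fun z => ENNReal.ofReal (z.2 ^ (β - 1)) * w z.1) (x, s)) hm2.aemeasurable]
  congr 1
  refine lintegral_congr fun s => ?_
  rw [← lintegral_const_mul _ (hw.indicator (measurableSet_lt measurable_const hg))]
  refine lintegral_congr fun x => ?_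
  by_cases h : ENNReal.ofReal s < g x <;> simp [indicator, h]

/-! ### The Hardy-Littlewood-Sobolev inequality -/

/-- The right-sided fractional integral of a nonnegative function, without the Gamma factor. -/
noncomputable def fracLIntegral (α : ℝ) (f : ℝ → ℝ≥0∞) (x : ℝ) : ℝ≥0∞ :=
  ∫⁻ t in Ioi (0 : ℝ), ENNReal.ofReal (t ^ (α - 1)) * f (x + t)

theorem measurable_setLIntegral_kernel (α : ℝ) {f : ℝ → ℝ≥0∞} (hf : Measurable f) (S : Set ℝ) :
    Measurable fun x => ∫⁻ t in S, ENNReal.ofReal (t ^ (α - 1)) * f (x + t) :=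
  Measurable.lintegral_prod_right' (f := fun z : ℝ × ℝ =>
    ENNReal.ofReal (z.2 ^ (α - 1)) * f (z.1 + z.2)) (by fun_prop)

theorem measurable_fracLIntegral (α : ℝ) {f : ℝ → ℝ≥0∞} (hf : Measurable f) :
    Measurable (fracLIntegral α f) :=
  measurable_setLIntegral_kernel α hf _

/-- Tonelli and translation invariance; the factor is the mass of the truncated kernel. -/
theorem lintegral_lintegral_Ioc_kernel {α R : ℝ} (hα : 0 < α) (hR : 0 ≤ R) {f : ℝ → ℝ≥0∞}
    (hf : Measurable f) :
    ∫⁻ x, ∫⁻ t in Ioc 0 R, ENNReal.ofReal (t ^ (α - 1)) * f (x + t) =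
      ENNReal.ofReal (R ^ α / α) * ∫⁻ x, f x := by
  rw [lintegral_lintegral_swap (by fun_prop)]
  have : ∀ t : ℝ, ∫⁻ x, ENNReal.ofReal (t ^ (α - 1)) * f (x + t) =
      ENNReal.ofReal (t ^ (α - 1)) * ∫⁻ x, f x := by
    intro t
    rw [lintegral_const_mul _ (by fun_prop), lintegral_add_right_eq_self]
  simp_rw [this]
  rw [lintegral_mul_const _ (by fun_prop), lintegral_Ioc_zero_rpow hα hR]

/-- Hölder: `α * p < 1` is exactly what makes the kernel tail lie in the dual space. -/
theorem lintegral_Ioi_kernel_le {α p R : ℝ} (hp : 1 < p) (hαp : α * p < 1)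
    (hR : 0 < R) {f : ℝ → ℝ≥0∞} (hf : Measurable f) (hf1 : ∫⁻ x, f x ^ p ≤ 1) (x : ℝ) :
    ∫⁻ t in Ioi R, ENNReal.ofReal (t ^ (α - 1)) * f (x + t) ≤
      ENNReal.ofReal (R ^ (α - 1 / p) * (p.conjExponent / p - α * p.conjExponent)⁻¹ ^
        (1 / p.conjExponent)) := by
  have hc : p.HolderConjugate p.conjExponent := Real.HolderConjugate.conjExponent hp
  set q := p.conjExponent
  have hq : 0 < q := hc.symm.pos
  have hinv := hc.inv_add_inv_eq_one
  have hp0 : 0 < p := hc.pos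
  have hαp' : α < 1 / p := by rwa [lt_div_iff₀ hp0]
  have hqp : q / p = q - 1 := by
    field_simp at hinv ⊢; linarith
  have hlt : α * q < q - 1 := by
    rw [← hqp]
    calc α * q < 1 / p * q := by gcongr
      _ = q / p := by ring
  calc ∫⁻ t in Ioi R, ENNReal.ofReal (t ^ (α - 1)) * f (x + t)
      ≤ (∫⁻ t in Ioi R, ENNReal.ofReal (t ^ (α - 1)) ^ q) ^ (1 / q) *
        (∫⁻ t in Ioi R, f (x + t) ^ p) ^ (1 / p) :=
        ENNReal.lintegral_mul_le_Lp_mul_Lq _ hc.symm (by fun_prop) (by fun_prop)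
    _ ≤ (∫⁻ t in Ioi R, ENNReal.ofReal (t ^ ((α - 1) * q))) ^ (1 / q) * 1 := by
        refine mul_le_mul' (ENNReal.rpow_le_rpow ?_ (by positivity)) ?_
        · refine setLIntegral_mono' measurableSet_Ioi fun t ht => le_of_eq ?_
          have ht0 : 0 < t := hR.trans ht
          rw [ENNReal.ofReal_rpow_of_nonneg (by positivity) hq.le, ← Real.rpow_mul ht0.le]
        · refine ENNReal.rpow_le_one ?_ (by positivity)
          calc ∫⁻ t in Ioi R, f (x + t) ^ p ≤ ∫⁻ t, f (x + t) ^ p := setLIntegral_le_lintegral _ _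
            _ = ∫⁻ t, f t ^ p := lintegral_add_left_eq_self (fun t => f t ^ p) x
            _ ≤ 1 := hf1
    _ = _ := by
        have h0 : 0 ≤ (q / p - α * q)⁻¹ := by rw [inv_nonneg, hqp]; linarith
        rw [mul_one, lintegral_Ioi_rpow (by linarith) hR,
          ENNReal.ofReal_rpow_of_nonneg (div_nonneg (by positivity) (by linarith)) (by positivity),
          div_eq_mul_inv, Real.mul_rpow (by positivity) (inv_nonneg.2 (by linarith)),
          ← Real.rpow_mul hR.le, hqp]
        congr 3
        · field_simp at hinv ⊢
          linarith
        · ring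

/-- The part of `fracLIntegral α f` not carried by the large values of `f` near the base point. -/
theorem exists_fracLIntegral_le {α p : ℝ} (hα : 0 < α) (hp : 1 < p) (hαp : α * p < 1) :
    ∃ A : ℝ, 0 < A ∧ ∀ f : ℝ → ℝ≥0∞, Measurable f → ∫⁻ x, f x ^ p ≤ 1 → ∀ s : ℝ, 0 < s → ∀ x,
      fracLIntegral α f x ≤ ENNReal.ofReal (A * s ^ (1 - α * p)) +
        ∫⁻ t in Ioc 0 (s ^ (-p)), ENNReal.ofReal (t ^ (α - 1)) *
          {x | ENNReal.ofReal s < f x}.indicator f (x + t) := by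
  set B := (p.conjExponent / p - α * p.conjExponent)⁻¹ ^ (1 / p.conjExponent)
  refine ⟨1 / α + |B|, by positivity, fun f hf hf1 s hs x => ?_⟩
  -- This radius balances the two bounded pieces: `R ^ α * s` and `R ^ (α - 1 / p)` both equal `s ^
  -- (1 - α * p)`.
  set R := s ^ (-p)
  have hR : 0 < R := by positivity
  have hms : MeasurableSet {x | ENNReal.ofReal s < f x} := measurableSet_lt measurable_const hf
  have hsplit : fracLIntegral α f x = (∫⁻ t in Ioc 0 R, ENNReal.ofReal (t ^ (α - 1)) * f (x + t)) +
      ∫⁻ t in Ioi R, ENNReal.ofReal (t ^ (α - 1)) * f (x + t) := by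
    rw [fracLIntegral, ← Ioc_union_Ioi_eq_Ioi hR.le,
      lintegral_union measurableSet_Ioi (Ioc_disjoint_Ioi le_rfl)]
  have hnear : ∫⁻ t in Ioc 0 R, ENNReal.ofReal (t ^ (α - 1)) * f (x + t) ≤
      ENNReal.ofReal (R ^ α / α) * ENNReal.ofReal s + ∫⁻ t in Ioc 0 R,
        ENNReal.ofReal (t ^ (α - 1)) * {x | ENNReal.ofReal s < f x}.indicator f (x + t) := by
    rw [← lintegral_Ioc_zero_rpow hα hR.le, ← lintegral_mul_const _ (by fun_prop),
      ← lintegral_add_left (by fun_prop)]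
    gcongr with t
    rw [← mul_add]
    gcongr
    by_cases h : ENNReal.ofReal s < f (x + t)
    · simp [indicator, h]
    · rw [indicator_of_notMem (show x + t ∉ {x | ENNReal.ofReal s < f x} from h), add_zero]
      exact not_lt.1 h
  have hfar := lintegral_Ioi_kernel_le hp hαp hR hf hf1 x
  have hR1 : R ^ α * s = s ^ (1 - α * p) := by
    rw [← Real.rpow_mul hs.le, ← Real.rpow_add_one hs.ne']
    congr 1; ring
  have hR2 : R ^ (α - 1 / p) = s ^ (1 - α * p) := by
    rw [← Real.rpow_mul hs.le]
    congr 1; field_simp; ring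
  rw [hR2] at hfar
  have hB : s ^ (1 - α * p) * B ≤ |B| * s ^ (1 - α * p) := by
    rw [mul_comm]; gcongr; exact le_abs_self B
  rw [← ENNReal.ofReal_mul (by positivity), div_mul_eq_mul_div, hR1] at hnear
  rw [hsplit, add_mul, ENNReal.ofReal_add (by positivity) (by positivity)]
  calc _ ≤ _ := add_le_add hnear (hfar.trans (ENNReal.ofReal_le_ofReal hB))
    _ = _ := by rw [one_div_mul_eq_div]; ring

/-- The Hardy-Littlewood-Sobolev inequality on the unit ball of `L^p`. -/
theorem exists_lintegral_fracLIntegral_rpow_le {α p : ℝ} (hα : 0 < α) (hp : 1 < p)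
    (hαp : α * p < 1) :
    ∃ C : ℝ, 0 < C ∧ ∀ f : ℝ → ℝ≥0∞, Measurable f → ∫⁻ x, f x ^ p ≤ 1 →
      ∫⁻ x, fracLIntegral α f x ^ (p / (1 - α * p)) ≤ ENNReal.ofReal C := by
  obtain ⟨A, hA, hmain⟩ := exists_fracLIntegral_le hα hp hαp
  have hκ : 0 < 1 - α * p := by linarith
  have hp0 : 0 < p := by linarith
  set q := p / (1 - α * p)
  have hq : 0 < q := by positivity
  refine ⟨(2 * A) ^ q * (p * (1 / (α * A) * (1 / (p - 1)))),
    by have := sub_pos.2 hp; positivity, fun f hf hf1 => ?_⟩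
  have hTm := measurable_fracLIntegral α hf
  set T := fracLIntegral α f
  -- With the factor 2, `g > s` means `T > 2 * A * s ^ (1 - α * p)`: half of this is taken by the
  -- bounded pieces, and the other half must come from the large values of `f`.
  set c := ENNReal.ofReal (2 * A)
  have hc0 : c ≠ 0 := by simpa [c] using hA
  have hct : c ≠ ⊤ := ENNReal.ofReal_ne_top
  set g : ℝ → ℝ≥0∞ := fun x => (T x / c) ^ (1 / (1 - α * p))
  have hg : Measurable g := by fun_prop
  have hTg : ∀ x, T x ^ q = c ^ q * g x ^ p := by
    intro x
    have : g x ^ p = (T x / c) ^ q := by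
      simp only [g]
      rw [← ENNReal.rpow_mul]
      congr 1; simp only [q]; ring
    rw [this, ← ENNReal.mul_rpow_of_nonneg _ _ hq.le, ENNReal.mul_div_cancel hc0 hct]
  -- Chebyshev for `N`; the powers of `s` combine to `s ^ (-1)`, so the layer cake weight drops from
  -- `p - 1` to `p - 2`, which is integrable at 0 because `p > 1`.
  have hlevel : ∀ s : ℝ, 0 < s → volume {x | ENNReal.ofReal s < g x} ≤
      ENNReal.ofReal (1 / (α * A) * s ^ (-1 : ℝ)) *
        ∫⁻ x, {x | ENNReal.ofReal s < f x}.indicator f x := by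
    intro s hs
    set N := fun x => ∫⁻ t in Ioc 0 (s ^ (-p)), ENNReal.ofReal (t ^ (α - 1)) *
          {x | ENNReal.ofReal s < f x}.indicator f (x + t)
    have hfs : Measurable ({x | ENNReal.ofReal s < f x}.indicator f) :=
      hf.indicator (measurableSet_lt measurable_const hf)
    have hN : Measurable N := measurable_setLIntegral_kernel α hfs _
    have hε : 0 < A * s ^ (1 - α * p) := by positivity
    have hsub : {x | ENNReal.ofReal s < g x} ⊆ {x | ENNReal.ofReal (A * s ^ (1 - α * p)) ≤ N x} := by
      intro x hx
      simp only [mem_ofPred_eq] at hx ⊢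
      have h1 : ENNReal.ofReal (s ^ (1 - α * p)) < T x / c := by
        have := ENNReal.rpow_lt_rpow hx hκ
        simp only [g] at this
        rwa [← ENNReal.rpow_mul, one_div_mul_cancel hκ.ne', ENNReal.rpow_one,
          ENNReal.ofReal_rpow_of_pos hs] at this
      rw [ENNReal.lt_div_iff_mul_lt (Or.inl hc0) (Or.inl hct), ← ENNReal.ofReal_mul (by positivity)]
        at h1
      have h2 := h1.trans_le (hmain f hf hf1 s hs x)
      rw [show s ^ (1 - α * p) * (2 * A) = A * s ^ (1 - α * p) + A * s ^ (1 - α * p) by ring,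
        ENNReal.ofReal_add hε.le hε.le] at h2
      exact (lt_of_add_lt_add_left h2).le
    calc volume {x | ENNReal.ofReal s < g x}
        ≤ volume {x | ENNReal.ofReal (A * s ^ (1 - α * p)) ≤ N x} := measure_mono hsub
      _ ≤ (∫⁻ x, N x) / ENNReal.ofReal (A * s ^ (1 - α * p)) :=
          meas_ge_le_lintegral_div hN.aemeasurable (by simpa using hε) ENNReal.ofReal_ne_top
      _ = _ := by
          rw [lintegral_lintegral_Ioc_kernel hα (by positivity) hfs, ENNReal.div_eq_inv_mul,
            ← mul_assoc, ← ENNReal.ofReal_inv_of_pos hε, ← ENNReal.ofReal_mul (by positivity)]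
          congr 2
          rw [← Real.rpow_mul hs.le, show -p * α = (1 - α * p) + (-1) by ring, Real.rpow_add hs]
          have : s ^ (1 - α * p) ≠ 0 := by positivity
          field_simp
  calc ∫⁻ x, T x ^ q = c ^ q * ∫⁻ x, g x ^ p := by
        simp_rw [hTg]; rw [lintegral_const_mul _ (by fun_prop)]
    _ = c ^ q * (ENNReal.ofReal p * ∫⁻ s in Ioi (0 : ℝ), ENNReal.ofReal (s ^ (p - 1)) *
          volume {x | ENNReal.ofReal s < g x}) := by
        have := lintegral_mul_rpow_eq_lintegral_Ioi hp0 (w := fun _ => 1) measurable_const hg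
        simp only [one_mul] at this
        rw [this]
        congr 2
        refine lintegral_congr fun s => ?_
        rw [lintegral_indicator (measurableSet_lt measurable_const hg)]
        simp
    _ ≤ c ^ q * (ENNReal.ofReal p * ∫⁻ s in Ioi (0 : ℝ), ENNReal.ofReal (1 / (α * A)) *
          (ENNReal.ofReal (s ^ ((p - 1) - 1)) *
            ∫⁻ x, {x | ENNReal.ofReal s < f x}.indicator f x)) := by
        refine mul_le_mul_right (mul_le_mul_right (setLIntegral_mono' measurableSet_Ioi fun s hs => ?_) _) _
        have hs : 0 < s := hs
        refine (mul_le_mul_right (hlevel s hs) _).trans_eq ?_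
        rw [← mul_assoc, ← mul_assoc, ← ENNReal.ofReal_mul (by positivity),
          ← ENNReal.ofReal_mul (by positivity), sub_eq_add_neg (p - 1) 1, Real.rpow_add hs (p - 1)]
        congr 2; ring
    _ = c ^ q * (ENNReal.ofReal p * (ENNReal.ofReal (1 / (α * A)) *
          (ENNReal.ofReal (1 / (p - 1)) * ∫⁻ x, f x ^ p))) := by
        have h1 := lintegral_mul_rpow_eq_lintegral_Ioi (sub_pos.2 hp) hf hf
        have hpp : ∀ x, f x * f x ^ (p - 1) = f x ^ p := by
          intro x
          conv_lhs => enter [1]; rw [← ENNReal.rpow_one (f x)]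
          rw [← ENNReal.rpow_add_of_nonneg _ _ zero_le_one (by linarith)]
          congr 1; ring
        simp_rw [hpp] at h1
        rw [lintegral_const_mul' _ _ ENNReal.ofReal_ne_top, h1, ← mul_assoc (ENNReal.ofReal (1 / (p - 1))),
          ← ENNReal.ofReal_mul (by have := sub_pos.2 hp; positivity),
          one_div_mul_cancel (sub_pos.2 hp).ne', ENNReal.ofReal_one, one_mul]
    _ ≤ c ^ q * (ENNReal.ofReal p * (ENNReal.ofReal (1 / (α * A)) *
          (ENNReal.ofReal (1 / (p - 1)) * 1))) := by gcongr
    _ = _ := by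
        have := sub_pos.2 hp
        rw [mul_one, ENNReal.ofReal_rpow_of_pos (by positivity), ← ENNReal.ofReal_mul (by positivity),
          ← ENNReal.ofReal_mul (by positivity), ← ENNReal.ofReal_mul (by positivity)]

/-- The Hardy-Littlewood-Sobolev inequality for one-sided fractional integrals. -/
theorem exists_eLpNorm_fracLIntegral_le {α p : ℝ} (hα : 0 < α) (hp : 1 < p)
    (hαp : α * p < 1) :
    ∃ C : ℝ, 0 < C ∧ ∀ f : ℝ → ℝ≥0∞, Measurable f →
      eLpNorm (fracLIntegral α f) (ENNReal.ofReal (p / (1 - α * p))) volume ≤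
        ENNReal.ofReal C * eLpNorm f (ENNReal.ofReal p) volume := by
  obtain ⟨C, hC, h⟩ := exists_lintegral_fracLIntegral_rpow_le hα hp hαp
  have hκ : 0 < 1 - α * p := by linarith
  have hp0 : 0 < p := by linarith
  set q := p / (1 - α * p)
  have hq : 0 < q := by positivity
  have norm_eq : ∀ {r : ℝ} (_ : 0 < r) (g : ℝ → ℝ≥0∞), eLpNorm g (ENNReal.ofReal r) volume =
      (∫⁻ x, g x ^ r) ^ (1 / r) := by
    intro r hr g
    rw [eLpNorm_eq_lintegral_rpow_enorm_toReal (by simpa using hr) ENNReal.ofReal_ne_top,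
      ENNReal.toReal_ofReal hr.le]
    simp
  refine ⟨C ^ (1 / q), by positivity, fun f hf => ?_⟩
  rw [norm_eq hq, norm_eq hp0]
  rw [← ENNReal.ofReal_rpow_of_pos hC]
  have hC0 : ENNReal.ofReal C ^ (1 / q) ≠ 0 := by simp [hC]
  have hCt : ENNReal.ofReal C ^ (1 / q) ≠ ⊤ := by simp [hq.le]
  rw [mul_comm, ← ENNReal.div_le_iff hC0 hCt]
  -- Normalising by any `l` above the norm, instead of by the norm, avoids division by zero.
  refine le_of_forall_gt_imp_ge_of_dense fun l hl => ?_
  rcases eq_or_ne l ⊤ with rfl | hlt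
  · exact le_top
  have hl0 : l ≠ 0 := (bot_le.trans_lt hl).ne'
  rw [ENNReal.div_le_iff hC0 hCt]
  have hf1 : ∫⁻ x, (l⁻¹ * f x) ^ p ≤ 1 := by
    simp_rw [ENNReal.mul_rpow_of_nonneg _ _ hp0.le]
    rw [lintegral_const_mul _ (by fun_prop), ENNReal.inv_rpow, mul_comm, ← div_eq_mul_inv]
    refine ENNReal.div_le_of_le_mul ?_
    rw [one_mul]
    have := ENNReal.rpow_le_rpow hl.le hp0.le
    rwa [← ENNReal.rpow_mul, one_div_mul_cancel hp0.ne', ENNReal.rpow_one] at this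
  have h1 := h (fun x => l⁻¹ * f x) (by fun_prop) hf1
  have hT : ∀ x, fracLIntegral α (fun x => l⁻¹ * f x) x = l⁻¹ * fracLIntegral α f x := by
    intro x
    rw [fracLIntegral, fracLIntegral, ← lintegral_const_mul' _ _ (by simpa using hl0)]
    exact lintegral_congr fun t => by ring
  simp_rw [hT, ENNReal.mul_rpow_of_nonneg _ _ hq.le] at h1
  have hTm := measurable_fracLIntegral α hf
  rw [lintegral_const_mul _ (by fun_prop)] at h1
  have h2 := ENNReal.rpow_le_rpow h1 (z := 1 / q) (by positivity)
  rw [ENNReal.mul_rpow_of_nonneg _ _ (by positivity), ← ENNReal.rpow_mul, mul_one_div_cancel hq.ne',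
    ENNReal.rpow_one, mul_comm, ← div_eq_mul_inv, ENNReal.div_le_iff hl0 hlt] at h2
  rwa [mul_comm l]

/-! ### Fractional integrals of test functions -/

/-- The left-sided fractional integral without the Gamma factor. -/
noncomputable def rlIntegral (σ : ℝ) (g : ℝ → ℝ) (x : ℝ) : ℝ :=
  ∫ t in Ioi (0 : ℝ), t ^ (σ - 1) * g (x - t)

/-- The convolution kernel of `rlIntegral`. -/
noncomputable def rlKernel (σ : ℝ) : ℝ → ℝ :=
  (Ioi (0 : ℝ)).indicator fun t => t ^ (σ - 1)

theorem setIntegral_Iio_eq_setIntegral_Ioi_sub (F : ℝ → ℝ) (x : ℝ) :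
    ∫ y in Iio x, F y = ∫ t in Ioi (0 : ℝ), F (x - t) := by
  rw [← integral_indicator measurableSet_Iio, ← integral_indicator measurableSet_Ioi,
    ← integral_sub_left_eq_self _ volume x]
  congr 1; ext t
  simp [indicator]

theorem fracIntegral_left_eq (σ : ℝ) (f : ℝ → ℝ) (x : ℝ) :
    fracIntegral FracSide.left σ f x = (Real.Gamma σ)⁻¹ * rlIntegral σ f x := by
  rw [fracIntegral, setIntegral_Iio_eq_setIntegral_Ioi_sub, rlIntegral]
  simp

theorem rlIntegral_eq_convolution (σ : ℝ) (g : ℝ → ℝ) :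
    rlIntegral σ g = convolution (rlKernel σ) g (ContinuousLinearMap.mul ℝ ℝ) volume := by
  ext x
  rw [convolution_def, rlIntegral, ← integral_indicator measurableSet_Ioi]
  congr 1; ext t
  by_cases h : 0 < t <;> simp [rlKernel, indicator, h]

theorem rlKernel_nonneg (σ t : ℝ) : 0 ≤ rlKernel σ t :=
  indicator_nonneg (fun _ ht => Real.rpow_nonneg (le_of_lt ht) _) t

theorem measurable_rlKernel (σ : ℝ) : Measurable (rlKernel σ) :=
  Measurable.indicator (by fun_prop) measurableSet_Ioi

theorem integrableOn_rlKernel {σ : ℝ} (hσ : 0 < σ) (b : ℝ) :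
    IntegrableOn (rlKernel σ) (Iic b) := by
  have h : IntegrableOn (fun t : ℝ => t ^ (σ - 1)) (Ioc 0 (max b 0)) :=
    (intervalIntegrable_iff_integrableOn_Ioc_of_le (le_max_right _ _)).1
      (intervalIntegral.intervalIntegrable_rpow' (by linarith))
  rw [IntegrableOn, rlKernel, integrable_indicator_iff measurableSet_Ioi, IntegrableOn,
    Measure.restrict_restrict measurableSet_Ioi]
  exact h.mono_set fun t ht => ⟨ht.1, ht.2.trans (le_max_left _ _)⟩

theorem locallyIntegrable_rlKernel {σ : ℝ} (hσ : 0 < σ) : LocallyIntegrable (rlKernel σ) volume :=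
  fun x => ⟨Iic (x + 1), Iic_mem_nhds (by linarith), integrableOn_rlKernel hσ _⟩

theorem contDiff_rlIntegral {σ : ℝ} (hσ : 0 < σ) {g : ℝ → ℝ} (hg : ContDiff ℝ ∞ g)
    (hc : HasCompactSupport g) : ContDiff ℝ ∞ (rlIntegral σ g) := by
  rw [rlIntegral_eq_convolution]
  exact hc.contDiff_convolution_right _ (locallyIntegrable_rlKernel hσ) hg

theorem hasDerivAt_rlIntegral {σ : ℝ} (hσ : 0 < σ) {g : ℝ → ℝ} (hg : ContDiff ℝ ∞ g)
    (hc : HasCompactSupport g) (x : ℝ) :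
    HasDerivAt (rlIntegral σ g) (rlIntegral σ (deriv g) x) x := by
  rw [rlIntegral_eq_convolution, rlIntegral_eq_convolution]
  exact hc.hasDerivAt_convolution_right _ (locallyIntegrable_rlKernel hσ)
    (hg.of_le (by exact_mod_cast le_top)) x

theorem deriv_rlIntegral {σ : ℝ} (hσ : 0 < σ) {g : ℝ → ℝ} (hg : ContDiff ℝ ∞ g)
    (hc : HasCompactSupport g) : deriv (rlIntegral σ g) = rlIntegral σ (deriv g) :=
  funext fun x => (hasDerivAt_rlIntegral hσ hg hc x).deriv

theorem fracDeriv_left_eq {α : ℝ} (hα : α < 1) {g : ℝ → ℝ} (hg : ContDiff ℝ ∞ g)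
    (hc : HasCompactSupport g) (x : ℝ) :
    fracDeriv FracSide.left α g x = (Real.Gamma (1 - α))⁻¹ * rlIntegral (1 - α) (deriv g) x := by
  have : fracIntegral FracSide.left (1 - α) g =
      fun x => (Real.Gamma (1 - α))⁻¹ * rlIntegral (1 - α) g x :=
    funext (fracIntegral_left_eq _ _)
  rw [fracDeriv, this]
  exact ((hasDerivAt_rlIntegral (by linarith) hg hc x).const_mul _).deriv

theorem integrableOn_rpow_mul_comp_sub {σ : ℝ} (hσ : 0 < σ) {g : ℝ → ℝ} (hg : Continuous g)
    (hc : HasCompactSupport g) (x : ℝ) :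
    IntegrableOn (fun t => t ^ (σ - 1) * g (x - t)) (Ioi 0) := by
  have := (hc.convolutionExists_right (ContinuousLinearMap.mul ℝ ℝ)
    (locallyIntegrable_rlKernel hσ) hg x).integrable.integrableOn (s := Ioi 0)
  refine this.congr_fun (fun t ht => ?_) measurableSet_Ioi
  have ht : 0 < t := ht
  simp [rlKernel, indicator, ht]

theorem rlIntegral_eq_add {σ : ℝ} (hσ : 0 < σ) {g : ℝ → ℝ} (hg : Continuous g)
    (hc : HasCompactSupport g) (x : ℝ) :
    rlIntegral σ g x = (∫ t in Ioc (0 : ℝ) 1, t ^ (σ - 1) * g (x - t)) +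
      ∫ t in Ioi (1 : ℝ), t ^ (σ - 1) * g (x - t) := by
  have h := integrableOn_rpow_mul_comp_sub hσ hg hc x
  rw [rlIntegral, ← Ioc_union_Ioi_eq_Ioi zero_le_one]
  exact setIntegral_union (Ioc_disjoint_Ioi le_rfl) measurableSet_Ioi
    (h.mono_set Ioc_subset_Ioi_self) (h.mono_set (Ioi_subset_Ioi zero_le_one))

theorem abs_integral_Ioc_rpow_mul_le {σ M : ℝ} (hσ : 0 < σ) {g : ℝ → ℝ}
    (hM : ∀ y, |g y| ≤ M) (x : ℝ) :
    |∫ t in Ioc (0 : ℝ) 1, t ^ (σ - 1) * g (x - t)| ≤ M / σ := by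
  have hi : IntegrableOn (fun t : ℝ => t ^ (σ - 1)) (Ioc 0 1) :=
    (intervalIntegrable_iff_integrableOn_Ioc_of_le zero_le_one).1
      (intervalIntegral.intervalIntegrable_rpow' (by linarith))
  calc |∫ t in Ioc (0 : ℝ) 1, t ^ (σ - 1) * g (x - t)|
      ≤ ∫ t in Ioc (0 : ℝ) 1, t ^ (σ - 1) * M := by
        refine (Real.norm_eq_abs _).symm.le.trans <| norm_integral_le_of_norm_le (hi.mul_const M) ?_
        refine (ae_restrict_mem measurableSet_Ioc).mono fun t ht => ?_
        rw [Real.norm_eq_abs, abs_mul, abs_of_nonneg (Real.rpow_nonneg ht.1.le _)]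
        exact mul_le_mul_of_nonneg_left (hM _) (Real.rpow_nonneg ht.1.le _)
    _ = M / σ := by
        rw [integral_mul_const, ← intervalIntegral.integral_of_le zero_le_one,
          integral_rpow (Or.inl (by linarith))]
        simp [hσ.ne', mul_comm, div_eq_mul_inv]

/-- Near the singularity use the supremum of `g`; beyond 1 the kernel is at most 1, so the `L^1`
norm suffices. -/
theorem exists_abs_rlIntegral_le {σ : ℝ} (hσ : 0 < σ) (hσ1 : σ ≤ 1) {g : ℝ → ℝ} (hg : Continuous g)
    (hc : HasCompactSupport g) : ∃ M, ∀ x, |rlIntegral σ g x| ≤ M := by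
  obtain ⟨M, hM⟩ := hg.bounded_above_of_compact_support hc
  have hgi : Integrable g := hg.integrable_of_hasCompactSupport hc
  refine ⟨M / σ + ∫ y, |g y|, fun x => ?_⟩
  rw [rlIntegral_eq_add hσ hg hc]
  refine (abs_add_le _ _).trans (add_le_add (abs_integral_Ioc_rpow_mul_le hσ hM x) ?_)
  have hgx : Integrable fun t => |g (x - t)| := (hgi.comp_sub_left x).abs
  calc |∫ t in Ioi (1 : ℝ), t ^ (σ - 1) * g (x - t)| ≤ ∫ t in Ioi (1 : ℝ), |g (x - t)| := by
        refine (Real.norm_eq_abs _).symm.le.trans <| norm_integral_le_of_norm_le hgx.integrableOn ?_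
        refine (ae_restrict_mem measurableSet_Ioi).mono fun t (ht : 1 < t) => ?_
        have h0 : 0 ≤ t ^ (σ - 1) := by positivity
        rw [Real.norm_eq_abs, abs_mul, abs_of_nonneg h0]
        exact mul_le_of_le_one_left (abs_nonneg _)
          (Real.rpow_le_one_of_one_le_of_nonpos ht.le (by linarith))
    _ ≤ ∫ t, |g (x - t)| :=
        setIntegral_le_integral hgx (Eventually.of_forall fun t => abs_nonneg _)
    _ = ∫ y, |g y| := integral_sub_left_eq_self (fun y => |g y|) volume x

/-- The bound does not involve the size of the support, so it is uniform over growing cutoffs. The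
kernel is not integrable at infinity, but integration by parts on `(1, ∞)` replaces it by the
integrable `t ^ (σ - 2)`; the boundary term and the new integral cost `M₀` each. -/
theorem abs_rlIntegral_deriv_le {σ M₀ M₁ : ℝ} (hσ : 0 < σ) (hσ1 : σ < 1) {F : ℝ → ℝ}
    (hF : ContDiff ℝ ∞ F) (hc : HasCompactSupport F) (h0 : ∀ y, |F y| ≤ M₀)
    (h1 : ∀ y, |deriv F y| ≤ M₁) (x : ℝ) :
    |rlIntegral σ (deriv F) x| ≤ M₁ / σ + 2 * M₀ := by
  have hF' : Continuous (deriv F) := hF.continuous_deriv (by simp)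
  have hint := integrableOn_rpow_mul_comp_sub hσ hF' hc.deriv x
  rw [rlIntegral_eq_add hσ hF' hc.deriv]
  refine (abs_add_le _ _).trans (add_le_add (abs_integral_Ioc_rpow_mul_le hσ h1 x) ?_)
  have hFi : Integrable fun t => F (x - t) :=
    (hF.continuous.integrable_of_hasCompactSupport hc).comp_sub_left x
  have hki : IntegrableOn (fun t : ℝ => t ^ (σ - 2)) (Ioi 1) :=
    integrableOn_Ioi_rpow_of_lt (by linarith) one_pos
  have hbound : ∀ᵐ t ∂volume.restrict (Ioi (1 : ℝ)),
      ‖(σ - 1) * t ^ (σ - 2) * -F (x - t)‖ ≤ (1 - σ) * M₀ * t ^ (σ - 2) := by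
    refine (ae_restrict_mem measurableSet_Ioi).mono fun t (ht : 1 < t) => ?_
    have hk : 0 ≤ t ^ (σ - 2) := by positivity
    rw [norm_mul, norm_mul, norm_neg, Real.norm_eq_abs, Real.norm_eq_abs, Real.norm_eq_abs,
      abs_of_nonneg hk, abs_of_neg (by linarith : σ - 1 < 0)]
    have := mul_le_mul_of_nonneg_left (h0 (x - t)) (mul_nonneg (by linarith : 0 ≤ -(σ - 1)) hk)
    linarith
  have hmeas : AEStronglyMeasurable (fun t => (σ - 1) * t ^ (σ - 2) * -F (x - t))
      (volume.restrict (Ioi (1 : ℝ))) := by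
    have := hF.continuous
    exact Measurable.aestronglyMeasurable (by fun_prop)
  have hparts := integral_Ioi_mul_deriv_eq_deriv_mul (a := (1 : ℝ)) (a' := -F (x - 1)) (b' := 0)
    (u := fun t => t ^ (σ - 1)) (v := fun t => -F (x - t))
    (u' := fun t => (σ - 1) * t ^ (σ - 2)) (v' := fun t => deriv F (x - t))
    (fun t (ht : 1 < t) => by
      have := Real.hasDerivAt_rpow_const (x := t) (p := σ - 1) (Or.inl (by linarith))
      rwa [show σ - 1 - 1 = σ - 2 by ring] at this)
    (fun t _ => by
      have hd : HasDerivAt F (deriv F (x - t)) (x - t) :=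
        (hF.differentiable (by simp) _).hasDerivAt
      have h := (hd.comp_const_sub x t).neg
      rw [neg_neg] at h
      exact h)
    (hint.mono_set (Ioi_subset_Ioi zero_le_one))
    ((hki.const_mul ((1 - σ) * M₀)).mono' hmeas hbound)
    (by
      have : ContinuousAt (fun t : ℝ => t ^ (σ - 1) * -F (x - t)) 1 := by
        refine ContinuousAt.mul (Real.continuousAt_rpow_const _ _ (Or.inl one_ne_zero)) ?_
        have := hF.continuous
        fun_prop
      have := this.tendsto
      simp only [Real.one_rpow, one_mul] at this
      exact this.mono_left nhdsWithin_le_nhds)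
    (by
      obtain ⟨r, hr⟩ := hc.isCompact.isBounded.subset_closedBall 0
      refine tendsto_const_nhds.congr' ?_
      filter_upwards [eventually_gt_atTop (x + r)] with t ht
      have : F (x - t) = 0 := by
        refine image_eq_zero_of_notMem_tsupport fun hmem => ?_
        have := hr hmem
        rw [mem_closedBall_zero_iff, Real.norm_eq_abs, abs_le] at this
        linarith [this.1]
      simp [this])
  rw [hparts, zero_sub, neg_neg]
  have h2 : |∫ t in Ioi (1 : ℝ), (σ - 1) * t ^ (σ - 2) * -F (x - t)| ≤ M₀ := by
    refine (norm_integral_le_of_norm_le (hki.const_mul ((1 - σ) * M₀)) hbound).trans_eq ?_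
    rw [integral_const_mul, integral_Ioi_rpow_of_lt (by linarith) one_pos, Real.one_rpow,
      show σ - 2 + 1 = -(1 - σ) by ring, neg_div_neg_eq, mul_right_comm,
      mul_one_div_cancel (by linarith), one_mul]
  refine (abs_sub _ _).trans ?_
  linarith [h0 (x - 1)]

/-! ### The beta integral and composition of fractional integrals -/

/-- The Euler beta integral. -/
noncomputable def eulerBeta (σ τ : ℝ) : ℝ :=
  ∫ t in (0 : ℝ)..1, t ^ (σ - 1) * (1 - t) ^ (τ - 1)

/-- Cut at `x / 2`, so that each half has one singularity; `t ↦ x - t` exchanges the halves. -/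
theorem intervalIntegrable_rpow_mul_sub_rpow {σ τ x : ℝ} (hσ : 0 < σ) (hτ : 0 < τ) (hx : 0 < x) :
    IntervalIntegrable (fun t : ℝ => t ^ (σ - 1) * (x - t) ^ (τ - 1)) volume 0 x := by
  have aux : ∀ {σ τ : ℝ}, 0 < σ →
      IntervalIntegrable (fun t : ℝ => t ^ (σ - 1) * (x - t) ^ (τ - 1)) volume 0 (x / 2) := by
    intro σ τ hσ
    refine (intervalIntegral.intervalIntegrable_rpow' (by linarith)).mul_continuousOn ?_
    refine ContinuousOn.rpow_const (by fun_prop) fun t ht => Or.inl ?_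
    rw [uIcc_of_le (by positivity)] at ht
    linarith [ht.2]
  refine (aux (τ := τ) hσ).trans ?_
  have h := (aux (τ := σ) hτ).comp_sub_left x
  simp only [sub_zero, sub_sub_cancel, sub_half] at h
  simpa only [mul_comm] using h.symm

theorem eulerBeta_pos {σ τ : ℝ} (hσ : 0 < σ) (hτ : 0 < τ) : 0 < eulerBeta σ τ :=
  intervalIntegral.intervalIntegral_pos_of_pos_on
    (intervalIntegrable_rpow_mul_sub_rpow hσ hτ one_pos)
    (fun _ ht => mul_pos (Real.rpow_pos_of_pos ht.1 _)
      (Real.rpow_pos_of_pos (sub_pos.2 ht.2) _)) one_pos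

theorem integral_rpow_mul_sub_rpow (σ τ : ℝ) {x : ℝ} (hx : 0 < x) :
    ∫ t in (0 : ℝ)..x, t ^ (σ - 1) * (x - t) ^ (τ - 1) = x ^ (σ + τ - 1) * eulerBeta σ τ := by
  have h := intervalIntegral.smul_integral_comp_mul_left (a := 0) (b := 1)
    (fun t : ℝ => t ^ (σ - 1) * (x - t) ^ (τ - 1)) x
  rw [mul_zero, mul_one] at h
  rw [← h, eulerBeta, smul_eq_mul, ← intervalIntegral.integral_const_mul,
    ← intervalIntegral.integral_const_mul]
  refine intervalIntegral.integral_congr fun t ht => ?_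
  rw [uIcc_of_le zero_le_one] at ht
  rw [show x - x * t = x * (1 - t) by ring, Real.mul_rpow hx.le ht.1,
    Real.mul_rpow hx.le (sub_nonneg.2 ht.2), show σ + τ - 1 = (σ - 1) + (τ - 1) + 1 by ring,
    Real.rpow_add hx, Real.rpow_add hx, Real.rpow_one]
  ring

theorem rlKernel_mul_rlKernel_sub (σ τ x : ℝ) :
    (fun t => rlKernel σ t * rlKernel τ (x - t)) =
      (Ioo 0 x).indicator fun t => t ^ (σ - 1) * (x - t) ^ (τ - 1) := by
  ext t
  by_cases h1 : 0 < t <;> by_cases h2 : t < x <;> simp [rlKernel, indicator, h1, h2]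

theorem convolutionExistsAt_rlKernel {σ τ : ℝ} (hσ : 0 < σ) (hτ : 0 < τ) (x : ℝ) :
    ConvolutionExistsAt (rlKernel σ) (rlKernel τ) x (ContinuousLinearMap.mul ℝ ℝ) volume := by
  simp only [ConvolutionExistsAt, ContinuousLinearMap.mul_apply', rlKernel_mul_rlKernel_sub]
  rw [integrable_indicator_iff measurableSet_Ioo]
  rcases le_or_gt x 0 with hx | hx
  · simp [Ioo_eq_empty_of_le hx]
  · exact ((intervalIntegrable_iff_integrableOn_Ioo_of_le hx.le).1
      (intervalIntegrable_rpow_mul_sub_rpow hσ hτ hx))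

/-- By scaling the convolution is a multiple of `x ^ (σ + τ - 1)`, and the exponent vanishes. -/
theorem convolution_rlKernel (σ τ : ℝ) (h : σ + τ = 1) :
    convolution (rlKernel σ) (rlKernel τ) (ContinuousLinearMap.mul ℝ ℝ) volume =
      (Ioi (0 : ℝ)).indicator fun _ => eulerBeta σ τ := by
  ext x
  simp only [convolution_def, ContinuousLinearMap.mul_apply', rlKernel_mul_rlKernel_sub]
  rw [integral_indicator measurableSet_Ioo]
  rcases le_or_gt x 0 with hx | hx
  · simp [indicator, hx]
  · rw [← integral_Ioc_eq_integral_Ioo, ← intervalIntegral.integral_of_le hx.le,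
      integral_rpow_mul_sub_rpow _ _ hx, h]
    simp [indicator, hx]

/-- Fractional integrals of complementary orders compose to the antiderivative. -/
theorem rlIntegral_rlIntegral_deriv {σ τ : ℝ} (hσ : 0 < σ) (hτ : 0 < τ) (h : σ + τ = 1)
    {g : ℝ → ℝ} (hg : ContDiff ℝ ∞ g) (hc : HasCompactSupport g) (x : ℝ) :
    rlIntegral σ (rlIntegral τ (deriv g)) x = eulerBeta σ τ * g x := by
  have hg' : Continuous (deriv g) := hg.continuous_deriv (by simp)
  have hnorm : ∀ σ, (fun x => ‖rlKernel σ x‖) = rlKernel σ := fun σ =>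
    funext fun t => Real.norm_of_nonneg (rlKernel_nonneg σ t)
  have hcn : HasCompactSupport fun x => ‖deriv g x‖ := hc.deriv.norm
  have hgn : Continuous fun x => ‖deriv g x‖ := hg'.norm
  rw [rlIntegral_eq_convolution, rlIntegral_eq_convolution,
    ← convolution_assoc (ContinuousLinearMap.mul ℝ ℝ) (ContinuousLinearMap.mul ℝ ℝ)
      (ContinuousLinearMap.mul ℝ ℝ) (ContinuousLinearMap.mul ℝ ℝ)
      (fun x y z => by simp [mul_assoc])
      (measurable_rlKernel σ).aestronglyMeasurable (measurable_rlKernel τ).aestronglyMeasurable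
      hg'.aestronglyMeasurable
      (Eventually.of_forall (convolutionExistsAt_rlKernel hσ hτ)), convolution_rlKernel σ τ h]
  · simp only [convolution_def, ContinuousLinearMap.mul_apply']
    have h1 : (fun t => (Ioi (0 : ℝ)).indicator (fun _ => eulerBeta σ τ) t * deriv g (x - t)) =
        (Ioi (0 : ℝ)).indicator fun t => eulerBeta σ τ * deriv g (x - t) := by
      ext t
      by_cases ht : 0 < t <;> simp [indicator, ht]
    rw [h1, integral_indicator measurableSet_Ioi, integral_const_mul,
      ← setIntegral_Iio_eq_setIntegral_Ioi_sub, ← integral_Iic_eq_integral_Iio,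
      hc.integral_Iic_deriv_eq (hg.of_le (by exact_mod_cast le_top))]
  · rw [hnorm]
    exact Eventually.of_forall (hcn.convolutionExists_right _ (locallyIntegrable_rlKernel hτ) hgn)
  · rw [hnorm, hnorm, ← rlIntegral_eq_convolution]
    obtain ⟨r, hr⟩ := hc.deriv.isCompact.isBounded.subset_closedBall 0
    have hG : Continuous (rlIntegral τ fun x => ‖deriv g x‖) := by
      rw [rlIntegral_eq_convolution]
      exact hcn.continuous_convolution_right _ (locallyIntegrable_rlKernel hτ) hgn
    have hG0 : ∀ y < -r, rlIntegral τ (fun x => ‖deriv g x‖) y = 0 := by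
      intro y hy
      refine setIntegral_eq_zero_of_forall_eq_zero fun t (ht : 0 < t) => ?_
      have : deriv g (y - t) = 0 := by
        refine image_eq_zero_of_notMem_tsupport fun hmem => ?_
        have := hr hmem
        rw [mem_closedBall_zero_iff, Real.norm_eq_abs, abs_le] at this
        linarith [this.1]
      simp [this]
    -- The kernel vanishes left of 0 and the inner integral left of `-r`, so only a bounded range of
    -- `t` matters.
    refine BddAbove.convolutionExistsAt _ (s := Icc 0 (x + r)) ?_ measurableSet_Icc ?_
      ((integrableOn_rlKernel hσ (x + r)).mono_set Icc_subset_Iic_self) hG.aestronglyMeasurable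
    · have hK : (fun t => x - t) ⁻¹' Icc 0 (x + r) = Icc (-r) x := by
        rw [preimage_const_sub_Icc]; congr 1 <;> ring
      rw [hK]
      exact (isCompact_Icc.image hG.norm).bddAbove
    · intro t ht
      simp only [ContinuousLinearMap.mul_apply', Function.mem_support] at ht
      constructor
      · by_contra hlt
        exact ht (by simp [rlKernel, indicator, (not_le.1 hlt).not_gt])
      · by_contra hlt
        rw [not_le] at hlt
        exact ht (by rw [hG0 _ (by linarith), mul_zero])

/-! ### Testing against functions without compact support -/

/-- Dilations of one bump by factors `n + 1 ≥ 1`, which can only decrease the derivative. -/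
theorem exists_cutoff : ∃ χ : ℕ → ℝ → ℝ, ∃ D : ℝ, (∀ n, ContDiff ℝ ∞ (χ n)) ∧
    (∀ n, HasCompactSupport (χ n)) ∧ (∀ n x, |χ n x| ≤ 1) ∧ (∀ n x, |deriv (χ n) x| ≤ D) ∧
    ∀ (n : ℕ) (x : ℝ), |x| < n + 1 → χ n x = 1 := by
  let b : ContDiffBump (0 : ℝ) := ⟨1, 2, one_pos, one_lt_two⟩
  have hb : ContDiff ℝ ∞ b := b.contDiff
  obtain ⟨D, hD⟩ := (hb.continuous_deriv (by simp)).bounded_above_of_compact_support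
    b.hasCompactSupport.deriv
  have hpos : ∀ n : ℕ, (0 : ℝ) < (n + 1 : ℝ)⁻¹ := fun n => by positivity
  refine ⟨fun n x => b ((n + 1 : ℝ)⁻¹ * x), D, fun n => by fun_prop, fun n => ?_, fun n x => ?_,
    fun n x => ?_, fun n x hx => ?_⟩
  · exact b.hasCompactSupport.comp_homeomorph (Homeomorph.mulLeft₀ _ (hpos n).ne')
  · rw [abs_of_nonneg b.nonneg]; exact b.le_one
  · have hd : HasDerivAt (fun x => b ((n + 1 : ℝ)⁻¹ * x))
        (deriv b ((n + 1 : ℝ)⁻¹ * x) * ((n + 1 : ℝ)⁻¹ * 1)) x :=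
      HasDerivAt.comp (h₂ := (b : ℝ → ℝ)) (h := fun x => (n + 1 : ℝ)⁻¹ * x) x (hb.differentiable (by simp) _).hasDerivAt
        ((hasDerivAt_id x).const_mul _)
    rw [hd.deriv, mul_one, abs_mul, abs_of_pos (hpos n)]
    refine (mul_le_of_le_one_right (abs_nonneg _) ?_).trans (hD _)
    exact inv_le_one_of_one_le₀ (by linarith [(Nat.cast_nonneg n : (0 : ℝ) ≤ n)])
  · refine b.one_of_mem_closedBall ?_
    rw [mem_closedBall_zero_iff, Real.norm_eq_abs, abs_mul, abs_of_pos (hpos n)]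
    exact (inv_mul_le_one₀ (by positivity)).2 hx.le

theorem rlIntegral_eq_zero_of_lt {σ r : ℝ} {g : ℝ → ℝ} (hr : ∀ y < -r, g y = 0) {x : ℝ}
    (hx : x < -r) : rlIntegral σ g x = 0 :=
  setIntegral_eq_zero_of_forall_eq_zero fun t (ht : 0 < t) => by
    rw [hr _ (by linarith), mul_zero]

/-- A weak derivative may be tested against fractional integrals of test functions. -/
theorem integral_mul_rlIntegral_eq {α : ℝ} (hα0 : 0 < α) (hα1 : α < 1) {u v : ℝ → ℝ}
    (hu : Integrable u) (hv : AEStronglyMeasurable v volume)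
    (huv : ∀ φ : ℝ → ℝ, ContDiff ℝ ∞ φ → HasCompactSupport φ →
      ∫ x, v x * φ x = ∫ x, u x * fracDeriv FracSide.left α φ x)
    {ψ : ℝ → ℝ} (hψ : ContDiff ℝ ∞ ψ) (hc : HasCompactSupport ψ)
    (hi : Integrable fun x => v x * rlIntegral α ψ x) :
    ∫ x, v x * rlIntegral α ψ x =
      (Real.Gamma (1 - α))⁻¹ * eulerBeta (1 - α) α * ∫ x, u x * ψ x := by
  obtain ⟨χ, D, hχ, hχc, hχ1, hχD, hχe⟩ := exists_cutoff
  set Φ := rlIntegral α ψ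
  have hΦ : ContDiff ℝ ∞ Φ := contDiff_rlIntegral hα0 hψ hc
  have hψ' : Continuous (deriv ψ) := hψ.continuous_deriv (by simp)
  obtain ⟨M₀, hM₀⟩ := exists_abs_rlIntegral_le hα0 hα1.le hψ.continuous hc
  obtain ⟨M₁, hM₁⟩ := exists_abs_rlIntegral_le hα0 hα1.le hψ' hc.deriv
  have hΦ' : deriv Φ = rlIntegral α (deriv ψ) := deriv_rlIntegral hα0 hψ hc
  obtain ⟨r, hr⟩ := hc.isCompact.isBounded.subset_closedBall 0
  have hψ0 : ∀ y < -r, ψ y = 0 := fun y hy => by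
    refine image_eq_zero_of_notMem_tsupport fun hmem => ?_
    have := hr hmem
    rw [mem_closedBall_zero_iff, Real.norm_eq_abs, abs_le] at this
    linarith [this.1]
  set φ : ℕ → ℝ → ℝ := fun n x => χ n x * Φ x
  have hφ : ∀ n, ContDiff ℝ ∞ (φ n) := fun n => (hχ n).mul hΦ
  have hφc : ∀ n, HasCompactSupport (φ n) := fun n => (hχc n).mul_right
  have hD0 : 0 ≤ D := (abs_nonneg _).trans (hχD 0 0)
  have hφ0 : ∀ n x, |φ n x| ≤ |Φ x| := fun n x => by
    simp only [φ]
    rw [abs_mul]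
    exact mul_le_of_le_one_left (abs_nonneg _) (hχ1 n x)
  have hφ1 : ∀ n x, |deriv (φ n) x| ≤ D * M₀ + M₁ := fun n x => by
    have hd : HasDerivAt (φ n) (deriv (χ n) x * Φ x + χ n x * deriv Φ x) x :=
      ((hχ n).differentiable (by simp) x).hasDerivAt.mul (hΦ.differentiable (by simp) x).hasDerivAt
    rw [hd.deriv]
    refine (abs_add_le _ _).trans (add_le_add ?_ ?_)
    · rw [abs_mul]; exact mul_le_mul (hχD n x) (hM₀ x) (abs_nonneg _) hD0
    · rw [abs_mul, hΦ']
      exact (mul_le_of_le_one_left (abs_nonneg _) (hχ1 n x)).trans (hM₁ x)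
  have hlim_left : Tendsto (fun n => ∫ x, v x * φ n x) atTop (𝓝 (∫ x, v x * Φ x)) := by
    refine tendsto_integral_of_dominated_convergence (fun x => ‖v x * Φ x‖)
      (fun n => hv.mul (hφ n).continuous.aestronglyMeasurable) hi.norm
      (fun n => Eventually.of_forall fun x => ?_) (Eventually.of_forall fun x => ?_)
    · rw [norm_mul (v x), norm_mul (v x)]
      exact mul_le_mul_of_nonneg_left (hφ0 n x) (norm_nonneg (v x))
    · refine tendsto_const_nhds.congr' ?_
      filter_upwards [eventually_ge_atTop ⌈|x|⌉₊] with n hn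
      have : |x| < n + 1 := (Nat.ceil_le.1 hn).trans_lt (by linarith)
      simp [φ, hχe n x this]
  have hderiv : ∀ x, ∀ᶠ n : ℕ in atTop,
      fracDeriv FracSide.left α (φ n) x = (Real.Gamma (1 - α))⁻¹ * (eulerBeta (1 - α) α * ψ x) := by
    intro x
    filter_upwards [eventually_ge_atTop ⌈max |x| r⌉₊] with n hn
    have hn' := Nat.ceil_le.1 hn
    have hxn : |x| < n + 1 := ((le_max_left _ _).trans hn').trans_lt (by linarith)
    have hrn : r < n + 1 := ((le_max_right _ _).trans hn').trans_lt (by linarith)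
    -- The cutoff changes nothing on the left, where `Φ` already vanishes, so the left derivative at
    -- `x` is that of `Φ` exactly and not just in the limit.
    have heq : ∀ y < (n + 1 : ℝ), φ n y = Φ y := by
      intro y hy
      by_cases hy2 : -(n + 1 : ℝ) < y
      · simp [φ, hχe n y (abs_lt.2 ⟨hy2, hy⟩)]
      · simp [φ, show Φ y = 0 from rlIntegral_eq_zero_of_lt hψ0 (by linarith)]
    rw [fracDeriv_left_eq hα1 (hφ n) (hφc n),
      ← rlIntegral_rlIntegral_deriv (sub_pos.2 hα1) hα0 (by ring) hψ hc, ← hΦ']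
    congr 1
    refine setIntegral_congr_fun measurableSet_Ioi fun t (ht : 0 < t) => ?_
    congr 1
    refine EventuallyEq.deriv_eq ?_
    have hlt : x - t < n + 1 := by linarith [le_abs_self x]
    filter_upwards [Iio_mem_nhds hlt] with y hy using heq y hy
  have hlim_right : Tendsto (fun n => ∫ x, u x * fracDeriv FracSide.left α (φ n) x) atTop
      (𝓝 (∫ x, u x * ((Real.Gamma (1 - α))⁻¹ * (eulerBeta (1 - α) α * ψ x)))) := by
    have hbound : ∀ n x, |fracDeriv FracSide.left α (φ n) x| ≤
        |(Real.Gamma (1 - α))⁻¹| * ((D * M₀ + M₁) / (1 - α) + 2 * M₀) := by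
      intro n x
      rw [fracDeriv_left_eq hα1 (hφ n) (hφc n), abs_mul]
      exact mul_le_mul_of_nonneg_left (abs_rlIntegral_deriv_le (sub_pos.2 hα1) (by linarith) (hφ n)
        (hφc n) (fun y => (hφ0 n y).trans (hM₀ y)) (hφ1 n) x) (abs_nonneg _)
    refine tendsto_integral_of_dominated_convergence
      (fun x => ‖u x‖ * (|(Real.Gamma (1 - α))⁻¹| * ((D * M₀ + M₁) / (1 - α) + 2 * M₀)))
      (fun n => hu.aestronglyMeasurable.mul ?_) (hu.norm.mul_const _)
      (fun n => Eventually.of_forall fun x => ?_) (Eventually.of_forall fun x => ?_)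
    · have : fracDeriv FracSide.left α (φ n) = deriv (fracIntegral FracSide.left (1 - α) (φ n)) :=
        rfl
      rw [this]
      exact (measurable_deriv _).aestronglyMeasurable
    · rw [norm_mul]
      exact mul_le_mul_of_nonneg_left (hbound n x) (norm_nonneg (u x))
    · refine tendsto_const_nhds.congr' ?_
      filter_upwards [hderiv x] with n hn
      rw [hn]
  have huniq := tendsto_nhds_unique hlim_left
    (hlim_right.congr fun n => (huv (φ n) (hφ n) (hφc n)).symm)
  rw [huniq, ← integral_const_mul]
  refine integral_congr_ae (Eventually.of_forall fun x => ?_)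
  simp only
  ring

/-! ### Fractional integration by parts -/

/-- The right-sided fractional integral without the Gamma factor. -/
noncomputable def rlIntegralRight (σ : ℝ) (g : ℝ → ℝ) (x : ℝ) : ℝ :=
  ∫ t in Ioi (0 : ℝ), t ^ (σ - 1) * g (x + t)

theorem lintegral_kernel_mul_comp_add (α : ℝ) {f g : ℝ → ℝ≥0∞} (hf : Measurable f)
    (hg : Measurable g) :
    ∫⁻ t in Ioi (0 : ℝ), ∫⁻ y, ENNReal.ofReal (t ^ (α - 1)) * (f (y + t) * g y) =
      ∫⁻ y, g y * fracLIntegral α f y := by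
  rw [lintegral_lintegral_swap (by fun_prop)]
  refine lintegral_congr fun y => ?_
  rw [fracLIntegral, ← lintegral_const_mul _ (by fun_prop)]
  exact lintegral_congr fun t => by ring

theorem lintegral_kernel_mul_comp_sub (α : ℝ) {f g : ℝ → ℝ≥0∞} (hf : Measurable f)
    (hg : Measurable g) :
    ∫⁻ t in Ioi (0 : ℝ), ∫⁻ x, ENNReal.ofReal (t ^ (α - 1)) * (f x * g (x - t)) =
      ∫⁻ y, g y * fracLIntegral α f y := by
  rw [← lintegral_kernel_mul_comp_add α hf hg]
  refine lintegral_congr fun t => ?_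
  rw [← lintegral_add_right_eq_self _ t]
  simp

theorem integrable_prod_kernel_mul (α : ℝ) {h : ℝ × ℝ → ℝ} (hh : Measurable h)
    (hfin : ∫⁻ t in Ioi (0 : ℝ), ∫⁻ x, ENNReal.ofReal (t ^ (α - 1)) * ‖h (t, x)‖ₑ ≠ ⊤) :
    Integrable (fun z : ℝ × ℝ => z.1 ^ (α - 1) * h z)
      ((volume.restrict (Ioi (0 : ℝ))).prod volume) := by
  have hm : Measurable fun z : ℝ × ℝ => z.1 ^ (α - 1) * h z := by fun_prop
  refine ⟨hm.aestronglyMeasurable, ?_⟩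
  rw [HasFiniteIntegral, lintegral_prod _ (by fun_prop)]
  refine lt_of_le_of_lt (setLIntegral_mono' measurableSet_Ioi fun t (ht : 0 < t) => ?_)
    (lt_top_iff_ne_top.2 hfin)
  refine lintegral_mono fun x => ?_
  have h0 : 0 ≤ t ^ (α - 1) := by positivity
  simp only
  rw [enorm_mul, Real.enorm_of_nonneg h0]

/-- Fractional integration by parts. -/
theorem integral_mul_rlIntegral_eq_integral_mul_rlIntegralRight (α : ℝ) {v ψ : ℝ → ℝ}
    (hv : Measurable v) (hψ : Measurable ψ)
    (hfin : ∫⁻ y, ‖ψ y‖ₑ * fracLIntegral α (fun x => ‖v x‖ₑ) y ≠ ⊤) :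
    Integrable (fun x => v x * rlIntegral α ψ x) ∧
      ∫ x, v x * rlIntegral α ψ x = ∫ y, ψ y * rlIntegralRight α v y := by
  have h1 := integrable_prod_kernel_mul α (h := fun z => v z.2 * ψ (z.2 - z.1)) (by fun_prop) (by
    simp only [enorm_mul]
    rwa [lintegral_kernel_mul_comp_sub α (f := fun x => ‖v x‖ₑ) (g := fun x => ‖ψ x‖ₑ)
      (by fun_prop) (by fun_prop)])
  have h2 := integrable_prod_kernel_mul α (h := fun z => v (z.2 + z.1) * ψ z.2) (by fun_prop) (by
    simp only [enorm_mul]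
    rwa [lintegral_kernel_mul_comp_add α (f := fun x => ‖v x‖ₑ) (g := fun x => ‖ψ x‖ₑ)
      (by fun_prop) (by fun_prop)])
  have e1 : ∀ x, v x * rlIntegral α ψ x =
      ∫ t in Ioi (0 : ℝ), t ^ (α - 1) * (v x * ψ (x - t)) := fun x => by
    rw [rlIntegral, ← integral_const_mul]
    exact integral_congr_ae (Eventually.of_forall fun t => by ring)
  have e2 : ∀ y, ψ y * rlIntegralRight α v y =
      ∫ t in Ioi (0 : ℝ), t ^ (α - 1) * (v (y + t) * ψ y) := fun y => by
    rw [rlIntegralRight, ← integral_const_mul]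
    exact integral_congr_ae (Eventually.of_forall fun t => by ring)
  constructor
  · simp_rw [e1]
    exact h1.integral_prod_right
  · simp_rw [e1, e2]
    rw [← integral_integral_swap (f := fun t x => t ^ (α - 1) * (v x * ψ (x - t))) h1,
      ← integral_integral_swap (f := fun t y => t ^ (α - 1) * (v (y + t) * ψ y)) h2]
    -- For fixed `t` the two inner integrals differ by a translation by `t`.
    refine integral_congr_ae (Eventually.of_forall fun t => ?_)
    simp only
    rw [← integral_add_right_eq_self _ t]
    simp

theorem enorm_rlIntegralRight_le (α : ℝ) (v : ℝ → ℝ) (y : ℝ) :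
    ‖rlIntegralRight α v y‖ₑ ≤ fracLIntegral α (fun x => ‖v x‖ₑ) y := by
  refine (enorm_integral_le_lintegral_enorm _).trans
    (setLIntegral_mono' measurableSet_Ioi fun t (ht : 0 < t) => ?_)
  have h0 : 0 ≤ t ^ (α - 1) := by positivity
  rw [enorm_mul, Real.enorm_of_nonneg h0]

theorem aestronglyMeasurable_rlIntegralRight (α : ℝ) {v : ℝ → ℝ} (hv : Measurable v) :
    AEStronglyMeasurable (rlIntegralRight α v) volume := by
  have : Measurable fun z : ℝ × ℝ => z.2 ^ (α - 1) * v (z.1 + z.2) := by fun_prop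
  exact this.stronglyMeasurable.integral_prod_right.aestronglyMeasurable

/-! ### Recovering a function from its weak derivative -/

theorem IsWeakFracDeriv.ae_eq {s : FracSide} {α : ℝ} {u v w : ℝ → ℝ} (hv : IsWeakFracDeriv s α u v)
    (hw : IsWeakFracDeriv s α u w) : v =ᵐ[volume] w :=
  ae_eq_of_integral_contDiff_smul_eq hv.1 hw.1 fun g hg hc => by
    simp only [smul_eq_mul, mul_comm (g _)]
    rw [hv.2 g hg hc, hw.2 g hg hc]

/-- Hölder. It supplies the absolute convergence that fractional integration by parts requires. -/
theorem lintegral_enorm_mul_ne_top {q : ℝ} (hq : 1 < q) {ψ : ℝ → ℝ} (hψ : Continuous ψ)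
    (hc : HasCompactSupport ψ) {g : ℝ → ℝ≥0∞} (hg : Measurable g)
    (hgq : eLpNorm g (ENNReal.ofReal q) volume ≠ ⊤) : ∫⁻ y, ‖ψ y‖ₑ * g y ≠ ⊤ := by
  have hq' : q.HolderConjugate q.conjExponent := Real.HolderConjugate.conjExponent hq
  have hψL := (hψ.memLp_of_hasCompactSupport hc (p := ENNReal.ofReal q.conjExponent)
    (μ := volume)).eLpNorm_ne_top
  have norm_eq : ∀ {ε : Type} [TopologicalSpace ε] [ESeminormedAddMonoid ε] {r : ℝ} (_ : 0 < r)
      (g : ℝ → ε), eLpNorm g (ENNReal.ofReal r) volume = (∫⁻ x, ‖g x‖ₑ ^ r) ^ (1 / r) := by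
    intro ε _ _ r hr g
    rw [eLpNorm_eq_lintegral_rpow_enorm_toReal (by simpa using hr) ENNReal.ofReal_ne_top,
      ENNReal.toReal_ofReal hr.le]
  rw [norm_eq hq'.symm.pos] at hψL
  rw [norm_eq hq'.pos] at hgq
  refine ne_top_of_le_ne_top (ENNReal.mul_ne_top hψL hgq) ?_
  exact ENNReal.lintegral_mul_le_Lp_mul_Lq volume hq'.symm
    hψ.measurable.enorm.aemeasurable hg.aemeasurable

/-- The fractional Sobolev inequality for the right-sided derivative. -/
theorem exists_eLpNorm_le_of_isWeakFracDeriv_right {α p : ℝ} (hα0 : 0 < α) (hα1 : α < 1)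
    (hp1 : 1 < p) (hαp : α * p < 1) :
    ∃ C : ℝ, 0 < C ∧ ∀ u v : ℝ → ℝ, Integrable u → MemLp v (ENNReal.ofReal p) volume →
      IsWeakFracDeriv FracSide.right α u v →
        eLpNorm u (ENNReal.ofReal (p / (1 - α * p))) volume ≤
          ENNReal.ofReal C * eLpNorm v (ENNReal.ofReal p) volume := by
  obtain ⟨C, hC, hHLS⟩ := exists_eLpNorm_fracLIntegral_le hα0 hp1 hαp
  have hκ : 0 < 1 - α * p := by linarith
  have hp0 : 0 < p := by linarith
  set q := p / (1 - α * p)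
  have hq : 1 < q := hp1.trans_le <| by
    rw [le_div_iff₀ hκ]
    nlinarith [mul_pos hp0 (mul_pos hα0 hp0)]
  have hΓ : 0 < Real.Gamma (1 - α) := Real.Gamma_pos_of_pos (by linarith)
  have hB : 0 < eulerBeta (1 - α) α := eulerBeta_pos (by linarith) hα0
  set c := (Real.Gamma (1 - α))⁻¹ * eulerBeta (1 - α) α
  have hc : 0 < c := by positivity
  refine ⟨c⁻¹ * C, by positivity, fun u v hu hv huv => ?_⟩
  obtain ⟨v₀, hv₀, hvv⟩ : ∃ v₀, Measurable v₀ ∧ v =ᵐ[volume] v₀ :=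
    ⟨hv.1.mk v, hv.1.stronglyMeasurable_mk.measurable, hv.1.ae_eq_mk⟩
  set f : ℝ → ℝ≥0∞ := fun x => ‖v₀ x‖ₑ
  have hf : Measurable f := hv₀.enorm
  have hfv : eLpNorm f (ENNReal.ofReal p) volume = eLpNorm v (ENNReal.ofReal p) volume := by
    rw [eLpNorm_enorm, eLpNorm_congr_ae hvv]
  have hT := hHLS f hf
  rw [hfv] at hT
  have hTfin : eLpNorm (fracLIntegral α f) (ENNReal.ofReal q) volume ≠ ⊤ :=
    ne_top_of_le_ne_top (ENNReal.mul_ne_top ENNReal.ofReal_ne_top hv.eLpNorm_ne_top) hT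
  set w := rlIntegralRight α v₀
  have hwT : eLpNorm w (ENNReal.ofReal q) volume ≤
      eLpNorm (fracLIntegral α f) (ENNReal.ofReal q) volume :=
    eLpNorm_mono_enorm fun y => by simpa using enorm_rlIntegralRight_le α v₀ y
  have hw : MemLp w (ENNReal.ofReal q) volume :=
    ⟨aestronglyMeasurable_rlIntegralRight α hv₀, hwT.trans_lt (lt_top_iff_ne_top.2 hTfin)⟩
  -- Both sides have the same integral against every `ψ`: test `v₀` with the left integral of `ψ`,
  -- then move that integral onto `v₀`. Only `c ≠ 0` is needed to solve for `u`.
  have hae : (fun x => c * u x) =ᵐ[volume] w := by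
    refine ae_eq_of_integral_contDiff_smul_eq (hu.const_mul c).locallyIntegrable
      (hw.locallyIntegrable (by simpa using hq.le)) fun ψ hψ hψc => ?_
    obtain ⟨hi, hswap⟩ := integral_mul_rlIntegral_eq_integral_mul_rlIntegralRight α hv₀
      hψ.continuous.measurable (lintegral_enorm_mul_ne_top hq hψ.continuous hψc
        (measurable_fracLIntegral α hf) hTfin)
    have hid := integral_mul_rlIntegral_eq hα0 hα1 hu hv₀.aestronglyMeasurable
      (fun φ hφ hφc => by
        refine Eq.trans ?_ (huv.2 φ hφ hφc)
        exact integral_congr_ae (hvv.mono fun x hx => by simp only [hx])) hψ hψc hi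
    simp only [smul_eq_mul]
    rw [← hswap, hid, ← integral_const_mul]
    exact integral_congr_ae (Eventually.of_forall fun x => by ring)
  have hu' : u =ᵐ[volume] c⁻¹ • w := hae.mono fun x hx => by
    simp only [Pi.smul_apply, smul_eq_mul, ← hx]
    field_simp
  rw [eLpNorm_congr_ae hu', eLpNorm_const_smul, Real.enorm_of_nonneg (by positivity),
    ENNReal.ofReal_mul (by positivity), mul_assoc]
  gcongr
  exact hwT.trans hT

/-! ### Reflection and the two signs -/

theorem fracIntegral_right_comp_neg (σ : ℝ) (f : ℝ → ℝ) (x : ℝ) :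
    fracIntegral FracSide.right σ (fun y => f (-y)) x = fracIntegral FracSide.left σ f (-x) := by
  simp only [fracIntegral]
  rw [← integral_Iic_eq_integral_Iio, ← integral_comp_neg_Ioi]
  congr 2
  ext y
  rw [show -x - -y = y - x by ring]

theorem fracDeriv_right_comp_neg (α : ℝ) (f : ℝ → ℝ) (x : ℝ) :
    fracDeriv FracSide.right α (fun y => f (-y)) (-x) = fracDeriv FracSide.left α f x := by
  have : fracIntegral FracSide.right (1 - α) (fun y => f (-y)) =
      fun x => fracIntegral FracSide.left (1 - α) f (-x) :=
    funext (fracIntegral_right_comp_neg _ f)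
  rw [fracDeriv, fracDeriv, this, deriv_comp_neg]
  simp

theorem IsWeakFracDeriv.comp_neg {α : ℝ} {u v : ℝ → ℝ} (h : IsWeakFracDeriv FracSide.left α u v) :
    IsWeakFracDeriv FracSide.right α (fun x => u (-x)) fun x => v (-x) := by
  refine ⟨?_, fun φ hφ hc => ?_⟩
  · intro x
    obtain ⟨t, ht, hi⟩ := h.1 (-x)
    refine ⟨Neg.neg ⁻¹' t, continuous_neg.continuousAt.preimage_mem_nhds ht, ?_⟩
    exact ((Measure.measurePreserving_neg volume).integrableOn_comp_preimage
      (Homeomorph.neg ℝ).measurableEmbedding).2 hi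
  · have h1 := h.2 (fun x => φ (-x)) (by fun_prop) (hc.comp_homeomorph (Homeomorph.neg ℝ))
    rw [← integral_neg_eq_self, ← integral_neg_eq_self (fun x => u x * _)] at h1
    simp only [neg_neg, FracSide.opp, fracDeriv_right_comp_neg] at h1
    exact h1

theorem mainTheorem7 (s : FracSide) (α p : ℝ) (hα0 : 0 < α) (hα1 : α < 1)
    (hp1 : 1 < p) (hp : p < 1 / α) :
    ∃ C : ℝ, 0 < C ∧ ∀ u v : ℝ → ℝ,
      MemLp u 1 volume → u ∈ fracSobolev s α (ENNReal.ofReal p) → IsWeakFracDeriv s α u v →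
        eLpNorm u (ENNReal.ofReal (p / (1 - α * p))) volume ≤
          ENNReal.ofReal C * eLpNorm v (ENNReal.ofReal p) volume := by
  have hαp : α * p < 1 := by rwa [lt_div_iff₀' hα0] at hp
  obtain ⟨C, hC, h⟩ := exists_eLpNorm_le_of_isWeakFracDeriv_right hα0 hα1 hp1 hαp
  refine ⟨C, hC, fun u v hu ⟨_, v', hv', huv'⟩ huv => ?_⟩
  -- Membership in the space provides some derivative in `L^p`; uniqueness transfers this to the
  -- given `v`.
  have hv : MemLp v (ENNReal.ofReal p) volume := hv'.ae_eq (huv'.ae_eq huv)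
  have hneg := Measure.measurePreserving_neg (volume : Measure ℝ)
  cases s with
  | right => exact h u v (memLp_one_iff_integrable.1 hu) hv huv
  | left =>
    have := h _ _ (memLp_one_iff_integrable.1 (hu.comp_measurePreserving hneg))
      (hv.comp_measurePreserving hneg) huv.comp_neg
    rwa [eLpNorm_comp_measurePreserving hu.1 hneg, eLpNorm_comp_measurePreserving hv.1 hneg] at this
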